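/- **Theorem 24 (Characterisation of linear orders on abelian groups).** Let $G$ be a torsion-free abelian group and let $E\subseteq G$ be a maximal independent set, i.e. a maximal $\mathbb Z$-linearly independent subset. Let $\bigoplus_E\mathbb R$ be the real vector space of finitely supported functions $E\to\mathbb R$, let $\bigoplus_E\mathbb Q\subseteq\bigoplus_E\mathbb R$ be the set of functions with rational values, and let $\varphi:G\to\bigoplus_E\mathbb R$ be the canonical embedding: $\varphi(g)=p/q$ whenever $q g=\sum_{e\in E}p(e)e$ with $q\in\mathbb N\setminus\{0\}$ and $p\in\bigoplus_E\mathbb Z$. *Notation.* A linear order on $G$ means a linear order compatible with addition; a linear vector space order on $\bigoplus_E\mathbb R$ is a linear order compatible with addition and with multiplication by non-negative reals. Such an order $\le$ on $\bigoplus_E\mathbb R$ induces the order $g\le h:\Leftrightarrow\varphi(g)\le\varphi(h)$ on $G$. For $a\in\bigoplus_E\mathbb R$ let $|a|=a$ if $0\le a$ and $|a|=-a$ otherwise, and let $$V_a=\mathcal L\{x\mid 0\le x\le|a|\},\qquad H_a=\mathcal L\{x\mid 0\le x \text{ and } n x\le|a|\text{ for all }n\in\mathbb Z\},$$ where $\mathcal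 L$ is the real linear hull. For a subspace $W$ of $\bigoplus_E\mathbb R$ let $\operatorname{Act}W=\mathcal L\bigl(W\cap\bigoplus_E\mathbb Q\bigr)$ be its active subspace and $W_+=\{x\in W\mid 0\le x\}$. For a second order $\le'$, the corresponding objects are written $V'_a$, $H'_a$, $(H'_a)_+$. *Statement.* Every linear order on $G$ is induced by some linear vector space order on $\bigoplus_E\mathbb R$. Let $\le$ and $\le'$ be linear orders on $G$, induced by linear vector space orders on $\bigoplus_E\mathbb R$ that are denoted by the same symbols, and let $U\subseteq\bigoplus_E\mathbb Q$ be a set with $$\bigoplus_E\mathbb R=\bigcup_{a\in U}V_a .$$ Then $\le$ and $\le'$ are different orders on $G$ if and only if some $a\in U$ fulfils one of the following conditions: 1. $H_a\cap\operatorname{Act}V_a\ne H'_a\cap\operatorname{Act}V'_a$; 2. $\operatorname{Act}V_a\ne\operatorname{Act}V'_a$; 3. $(H_a)_+\cap\bigoplus_E\mathbb Q\ne(H'_a)_+\cap\bigoplus_E\mathbb Q$; 4. exactly one of $0\le a$ and $0\le' a$ holds. In particular, if every $a\in U$ has the same sign in both orders (for instance, is non-negative in both), then $\le$ and $\le'$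 are different on $G$ if and only if some $a\in U$ fulfils one of the conditions 1, 2, 3. -/

import Mathlib

/-- `E` is a maximal independent subset of the abelian group `G`: it is linearly independent over
`ℤ`, and maximal with this property with respect to inclusion. -/
def IsMaximalIndependent {G : Type*} [AddCommGroup G] (E : Set G) : Prop :=
  Maximal (fun S : Set G => LinearIndepOn ℤ id S) E

/-- A positive multiple of every element is an integral combination of the elements of `E`. -/
theorem IsMaximalIndependent.exists_multiple {G : Type*} [AddCommGroup G] {E : Set G}
    (hE : IsMaximalIndependent E) (g : G) :
    ∃ (q : ℕ) (p : E →₀ ℤ), 0 < q ∧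
      q • g = Finsupp.linearCombination ℤ (fun e : E => (e : G)) p := by
  classical
  by_cases hg : g ∈ E
  · exact ⟨1, Finsupp.single ⟨g, hg⟩ 1, one_pos, by simp⟩
  have hne : ¬ LinearIndepOn ℤ id (insert g E) := fun h =>
    hg (hE.2 h (Set.subset_insert g E) (Set.mem_insert g E))
  rw [linearIndepOn_iff] at hne
  push Not at hne
  obtain ⟨l, hl, hl0, hlne⟩ := hne
  have hsub : ∀ x ∈ (l.erase g).support, x ∈ E := by
    intro x hx
    rw [Finsupp.support_erase, Finset.mem_erase] at hx
    exact ((Finsupp.mem_supported _ _).1 hl (Finset.mem_coe.2 hx.2)).resolve_left hx.1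
  have hsplit : l g • g + Finsupp.linearCombination ℤ id (l.erase g) = 0 := by
    conv_rhs => rw [← hl0, ← Finsupp.single_add_erase g l]
    simp
  have hsubty : Finsupp.linearCombination ℤ (fun e : E => (e : G))
      ((l.erase g).subtypeDomain (fun x => x ∈ E)) =
        Finsupp.linearCombination ℤ id (l.erase g) := by
    rw [Finsupp.linearCombination_apply, Finsupp.linearCombination_apply]
    exact Finsupp.sum_subtypeDomain_index (h := fun a b => b • id a) hsub
  have hlg : l g ≠ 0 := by
    intro h0
    apply hlne
    have hlE : l ∈ Finsupp.supported ℤ ℤ E := by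
      rw [Finsupp.mem_supported]
      intro x hx
      refine ((Finsupp.mem_supported _ _).1 hl hx).resolve_left ?_
      rintro rfl
      exact (Finsupp.mem_support_iff.1 (Finset.mem_coe.1 hx)) h0
    exact linearIndepOn_iff.1 hE.1 l hlE hl0
  set p := (l.erase g).subtypeDomain (fun x => x ∈ E) with hp
  have heq : l g • g = - Finsupp.linearCombination ℤ (fun e : E => (e : G)) p := by
    rw [hsubty]
    exact eq_neg_of_add_eq_zero_left hsplit
  rcases le_total 0 (l g) with h | h
  · refine ⟨(l g).natAbs, -p, Int.natAbs_pos.2 hlg, ?_⟩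
    rw [map_neg, ← heq, ← natCast_zsmul, Int.natAbs_of_nonneg h]
  · refine ⟨(l g).natAbs, p, Int.natAbs_pos.2 hlg, ?_⟩
    rw [← natCast_zsmul, Int.ofNat_natAbs_of_nonpos h, neg_smul, heq, neg_neg]

/-- The canonical embedding of `G` into the real vector space `⊕_E ℝ`: if
`q g = ∑_{e ∈ E} p(e) e` with an integer `q > 0` and integers `p(e)`, then `g` is mapped to `p / q`.
(In a torsion free group the result does not depend on the choice of `q` and `p`.) -/
noncomputable def canonicalEmbedding {G : Type*} [AddCommGroup G] {E : Set G}
    (hE : IsMaximalIndependent E) (g : G) : E →₀ ℝ :=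
  ((hE.exists_multiple g).choose : ℝ)⁻¹ •
    (hE.exists_multiple g).choose_spec.choose.mapRange (fun n : ℤ => (n : ℝ)) Int.cast_zero

/-- The relation `le` is a linear order that makes the abelian group `A` an ordered group. -/
structure IsLinearGroupOrder {A : Type*} [AddCommGroup A] (le : A → A → Prop) : Prop where
  isLinearOrder : IsLinearOrder A le
  add_le_add : ∀ x y z : A, le x y → le (x + z) (y + z)

/-- The relation `le` is a linear order that makes the real vector space `V` an ordered
vector space. -/
structure IsLinearVectorOrder {V : Type*} [AddCommGroup V] [Module ℝ V] (le : V → V → Prop) : Prop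
    extends IsLinearGroupOrder le where
  smul_nonneg : ∀ (c : ℝ) (x : V), 0 ≤ c → le 0 x → le 0 (c • x)

/-- The relation `le` on `G` is induced, along the canonical embedding, by the relation `R`
on `⊕_E ℝ`. -/
def Induces {G : Type*} [AddCommGroup G] {E : Set G} (hE : IsMaximalIndependent E)
    (R : (E →₀ ℝ) → (E →₀ ℝ) → Prop) (le : G → G → Prop) : Prop :=
  ∀ g h : G, le g h ↔ R (canonicalEmbedding hE g) (canonicalEmbedding hE h)

/-- The rational vectors `⊕_E ℚ` inside `⊕_E ℝ`. -/
def rationalVectors (ι : Type*) : Set (ι →₀ ℝ) :=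
  {x | ∀ i, ∃ q : ℚ, (q : ℝ) = x i}

open Classical in
/-- The absolute value `|a|` with respect to a linear order. -/
noncomputable def orderAbs {V : Type*} [AddCommGroup V] (le : V → V → Prop) (a : V) : V :=
  if le 0 a then a else -a

/-- `x` is infinitesimal with respect to `b`: all integral multiples of `x` are below `b`. -/
def IsInfinitesimal {V : Type*} [AddCommGroup V] (le : V → V → Prop) (x b : V) : Prop :=
  ∀ n : ℤ, le (n • x) b

/-- The subspace `V_a`, the linear hull of all `x` with `0 ≤ x ≤ |a|`. -/
def orderSpan {V : Type*} [AddCommGroup V] [Module ℝ V] (le : V → V → Prop) (a : V) :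
    Submodule ℝ V :=
  Submodule.span ℝ {x | le 0 x ∧ le x (orderAbs le a)}

/-- The subspace `H_a`, the linear hull of all `x ≥ 0` that are infinitesimal with respect
to `|a|`. -/
def orderHyperplane {V : Type*} [AddCommGroup V] [Module ℝ V] (le : V → V → Prop) (a : V) :
    Submodule ℝ V :=
  Submodule.span ℝ {x | le 0 x ∧ IsInfinitesimal le x (orderAbs le a)}

/-- The active subspace of a subspace `W` of `⊕ ℝ`: the real linear hull of the rational
vectors in `W`. -/
noncomputable def activeSubspace {ι : Type*} (W : Submodule ℝ (ι →₀ ℝ)) : Submodule ℝ (ι →₀ ℝ) :=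
  Submodule.span ℝ (rationalVectors ι ∩ (W : Set (ι →₀ ℝ)))

/-- The positive cone `W_+` of a subspace `W` with respect to the restriction of the order. -/
def positivePart {V : Type*} [AddCommGroup V] [Module ℝ V] (le : V → V → Prop)
    (W : Submodule ℝ V) : Set V :=
  {x | x ∈ W ∧ le 0 x}

/-- The two orders `R`, `R'` on `⊕ ℝ` are distinguished at the vector `a` by one of: the hyperplanes
restricted to the active subspaces, the active subspaces, the rational positive parts of the
hyperplanes. -/
def DifferAt {ι : Type*} (R R' : (ι →₀ ℝ) → (ι →₀ ℝ) → Prop) (a : ι →₀ ℝ) : Prop :=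
  orderHyperplane R a ⊓ activeSubspace (orderSpan R a) ≠
      orderHyperplane R' a ⊓ activeSubspace (orderSpan R' a) ∨
    activeSubspace (orderSpan R a) ≠ activeSubspace (orderSpan R' a) ∨
    positivePart R (orderHyperplane R a) ∩ rationalVectors ι ≠
      positivePart R' (orderHyperplane R' a) ∩ rationalVectors ι

/-! Every rational vector has a positive multiple in the image of `G`, so an order on `G` amounts to
the signs of the rational vectors.

Each `x ∈ V_a` has the form `s • a + h` with `h ∈ H_a`, and for `s ≠ 0`, `a ≠ 0` the sign of `x` is
that of `s • a`. Suppose `a` fulfils none of the conditions, and let `x ∈ V_a` be rational. If `x ∈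
H_a`, condition 3 settles its sign. Otherwise `s • a ≠ 0`; since `x` and `a` are rational, `h` lies
in `Act V_a`, so by condition 1 the same decomposition is valid for the second order, and the sign
of `a` decides (`nonneg_of_not_differAt`). The covering by the `V_a` reaches all rational `x`.

Conversely, orders that agree on rational vectors have the same rational vectors in `V_a` and in
`H_a`. The delicate point is condition 1, as `H_a ∩ Act V_a` need not be spanned by rational
vectors. But for rational `x` the coefficient of `|a|` is the supremum of the rationals `q` with `q
• |a| ≤ x`, hence common to both orders; by linearity a common coefficient exists on all of `Act
V_a`, and membership in the hyperplane means that the `|a|`-component vanishes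
(`not_differAt_of_nonneg_iff`).

Extensions exist by Hahn's embedding theorem (`exists_isLinearVectorOrder_induces`). -/

/-! ### The canonical embedding and rational vectors. -/

theorem canonicalEmbedding_eq {G : Type*} [AddCommGroup G] {E : Set G}
    (hE : IsMaximalIndependent E) {g : G} {q : ℕ} (hq : 0 < q) {p : E →₀ ℤ}
    (h : q • g = Finsupp.linearCombination ℤ (fun e : E => (e : G)) p) (e : E) :
    canonicalEmbedding hE g e = (q : ℝ)⁻¹ * p e := by
  obtain ⟨hq', h'⟩ := (hE.exists_multiple g).choose_spec.choose_spec
  set q' := (hE.exists_multiple g).choose with hq'def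
  set p' := (hE.exists_multiple g).choose_spec.choose with hp'def
  have hval : canonicalEmbedding hE g e = (q' : ℝ)⁻¹ * p' e := by
    simp only [canonicalEmbedding, Finsupp.smul_apply, Finsupp.mapRange_apply, smul_eq_mul]
    rfl
  have hinj : LinearIndependent ℤ (fun e : E => (e : G)) := hE.1
  -- Both sides represent `(q * q') • g`, and `E` is independent.
  have hpp : (q : ℤ) • p' = (q' : ℤ) • p := by
    apply hinj
    rw [map_smul, map_smul, ← h, ← h', natCast_zsmul, natCast_zsmul, smul_smul, smul_smul,
      mul_comm]
  have hpe : (q : ℝ) * p' e = q' * p e := by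
    have := DFunLike.congr_fun hpp e
    simp only [Finsupp.smul_apply, smul_eq_mul] at this
    exact_mod_cast this
  have h1 : (q : ℝ) ≠ 0 := by positivity
  have h2 : (q' : ℝ) ≠ 0 := by positivity
  rw [hval]
  field_simp
  linarith

theorem canonicalEmbedding_mem_rationalVectors {G : Type*} [AddCommGroup G] {E : Set G}
    (hE : IsMaximalIndependent E) (g : G) : canonicalEmbedding hE g ∈ rationalVectors E := by
  intro e
  obtain ⟨q, p, hq, h⟩ := hE.exists_multiple g
  exact ⟨(q : ℚ)⁻¹ * p e, by rw [canonicalEmbedding_eq hE hq h]; push_cast; rfl⟩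

theorem canonicalEmbedding_zero {G : Type*} [AddCommGroup G] {E : Set G}
    (hE : IsMaximalIndependent E) : canonicalEmbedding hE 0 = 0 := by
  ext e
  rw [canonicalEmbedding_eq hE one_pos (p := 0) (by simp)]
  simp

/-- Every rational vector has a positive multiple in the image of the canonical embedding. -/
theorem exists_nsmul_eq_canonicalEmbedding {G : Type*} [AddCommGroup G] {E : Set G}
    (hE : IsMaximalIndependent E) {x : E →₀ ℝ} (hx : x ∈ rationalVectors E) :
    ∃ (d : ℕ) (g : G), 0 < d ∧ (d : ℝ) • x = canonicalEmbedding hE g := by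
  classical
  choose r hr using hx
  set d : ℕ := ∏ e ∈ x.support, (r e).den with hd
  have hd0 : 0 < d := Finset.prod_pos fun e _ => (r e).den_pos
  have hint : ∀ e, ∃ n : ℤ, (n : ℝ) = d * x e := by
    intro e
    by_cases he : e ∈ x.support
    · obtain ⟨k, hk⟩ := Finset.dvd_prod_of_mem (fun e => (r e).den) he
      refine ⟨k * (r e).num, ?_⟩
      rw [hd, hk, ← hr e]
      have hnum : ((r e).num : ℚ) = r e * (r e).den := (Rat.mul_den_eq_num _).symm
      have hnum' : ((r e).num : ℝ) = r e * (r e).den := by exact_mod_cast hnum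
      push_cast
      rw [hnum']
      ring
    · exact ⟨0, by simp [Finsupp.notMem_support_iff.1 he]⟩
  choose n hn using hint
  have hn0 : ∀ e, n e ≠ 0 → e ∈ x.support := by
    intro e he
    rw [Finsupp.mem_support_iff]
    intro h0
    apply he
    have := hn e
    rw [h0, mul_zero] at this
    exact_mod_cast this
  set p : E →₀ ℤ := Finsupp.onFinset x.support n hn0
  refine ⟨d, Finsupp.linearCombination ℤ (fun e : E => (e : G)) p, hd0, ?_⟩
  ext e
  rw [canonicalEmbedding_eq hE one_pos (p := p) (by simp)]
  simp [p, hn]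

/-- The linear order whose order relation is a given linear vector space order. -/
theorem IsLinearVectorOrder.exists_linearOrder {V : Type*} [AddCommGroup V] [Module ℝ V]
    {le : V → V → Prop} (h : IsLinearVectorOrder le) :
    ∃ o : LinearOrder V, le = o.le ∧ IsOrderedAddMonoid V ∧ PosSMulMono ℝ V := by
  classical
  have hl := h.isLinearOrder
  let o : LinearOrder V :=
    { le := le
      le_refl := hl.refl
      le_trans := hl.trans
      le_antisymm := hl.antisymm
      le_total := hl.total
      toDecidableLE := Classical.decRel _ }
  have h1 : IsOrderedAddMonoid V :=
    { add_le_add_left := fun a b hab c => h.add_le_add a b c hab }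
  exact ⟨o, rfl, h1, PosSMulMono.of_smul_nonneg fun c hc x hx => h.smul_nonneg c x hc hx⟩

/-! ### The subspaces `V_a` and `H_a` in an ordered vector space. -/

section Ordered

variable {V : Type*} [AddCommGroup V] [LinearOrder V] [IsOrderedAddMonoid V]

theorem orderAbs_eq_abs (a : V) : orderAbs (· ≤ ·) a = |a| := by
  unfold orderAbs
  split_ifs with h
  · exact (abs_of_nonneg h).symm
  · exact (abs_of_nonpos (le_of_not_ge h)).symm

variable [Module ℝ V] [PosSMulMono ℝ V]

theorem mem_orderSpan_iff {a x : V} :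
    x ∈ orderSpan (· ≤ ·) a ↔ ∃ n : ℕ, |x| ≤ (n : ℝ) • |a| := by
  unfold orderSpan
  rw [orderAbs_eq_abs]
  constructor
  · intro h
    induction h using Submodule.span_induction with
    | mem x h => exact ⟨1, by simpa [abs_of_nonneg h.1] using h.2⟩
    | zero => exact ⟨0, by simp⟩
    | add x y _ _ hx hy =>
      obtain ⟨m, hm⟩ := hx
      obtain ⟨n, hn⟩ := hy
      refine ⟨m + n, (abs_add_le x y).trans ?_⟩
      push_cast
      rw [add_smul]
      exact add_le_add hm hn
    | smul c x _ hx =>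
      obtain ⟨m, hm⟩ := hx
      obtain ⟨k, hk⟩ := exists_nat_ge |c|
      refine ⟨k * m, ?_⟩
      rw [abs_smul]
      push_cast
      rw [mul_smul]
      exact (smul_le_smul_of_nonneg_left hm (abs_nonneg c)).trans
        (smul_le_smul_of_nonneg_right hk (smul_nonneg (Nat.cast_nonneg m) (abs_nonneg a)))
  · rintro ⟨n, hn⟩
    have key : ∀ y : V, 0 ≤ y → y ≤ (n : ℝ) • |a| →
        y ∈ Submodule.span ℝ {x | 0 ≤ x ∧ x ≤ |a|} := by
      intro y hy0 hy
      rcases Nat.eq_zero_or_pos n with rfl | hn0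
      · have : y = 0 := le_antisymm (by simpa using hy) hy0
        rw [this]
        exact zero_mem _
      · have hn' : (0 : ℝ) < n := Nat.cast_pos.2 hn0
        have : (n : ℝ)⁻¹ • y ∈ Submodule.span ℝ {x | 0 ≤ x ∧ x ≤ |a|} := by
          refine Submodule.subset_span ⟨smul_nonneg (by positivity) hy0, ?_⟩
          have := smul_le_smul_of_nonneg_left hy (inv_nonneg.2 hn'.le)
          rwa [smul_smul, inv_mul_cancel₀ hn'.ne', one_smul] at this
        have := Submodule.smul_mem _ (n : ℝ) this
        rwa [smul_smul, mul_inv_cancel₀ hn'.ne', one_smul] at this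
    rcases le_total 0 x with h | h
    · exact key x h (by rwa [abs_of_nonneg h] at hn)
    · rw [← neg_neg x]
      exact neg_mem (key (-x) (neg_nonneg.2 h) (by rwa [abs_of_nonpos h] at hn))

/-- `H_a` consists of the vectors that are infinitesimal with respect to `|a|`. -/
theorem mem_orderHyperplane_iff_forall_real {a x : V} :
    x ∈ orderHyperplane (· ≤ ·) a ↔ ∀ r : ℝ, r • x ≤ |a| := by
  have nat_real : ∀ y : V, 0 ≤ y → (∀ n : ℤ, n • y ≤ |a|) → ∀ r : ℝ, r • y ≤ |a| := by
    intro y hy h r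
    obtain ⟨k, hk⟩ := exists_nat_ge r
    refine (smul_le_smul_of_nonneg_right hk hy).trans ?_
    have := h k
    rwa [natCast_zsmul, ← Nat.cast_smul_eq_nsmul ℝ] at this
  unfold orderHyperplane IsInfinitesimal
  rw [orderAbs_eq_abs]
  constructor
  · intro h
    induction h using Submodule.span_induction with
    | mem x h => exact nat_real x h.1 h.2
    | zero => simp
    | add x y _ _ hx hy =>
      intro r
      -- Doubling `r` bounds each summand by half of `|a|`.
      have h1 := hx (2 * r)
      have h2 := hy (2 * r)
      have h3 := smul_le_smul_of_nonneg_left (add_le_add h1 h2) (by norm_num : (0 : ℝ) ≤ 1 / 2)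
      rw [← smul_add, smul_smul, ← two_smul ℝ |a|, smul_smul] at h3
      norm_num at h3
      simpa using h3
    | smul c x _ hx =>
      intro r
      rw [smul_smul]
      exact hx _
  · intro h
    have key : ∀ y : V, 0 ≤ y → (∀ r : ℝ, r • y ≤ |a|) →
        y ∈ Submodule.span ℝ {x | 0 ≤ x ∧ ∀ n : ℤ, n • x ≤ |a|} := fun y hy0 hy =>
      Submodule.subset_span ⟨hy0, fun n => by simpa [Int.cast_smul_eq_zsmul] using hy n⟩
    rcases le_total 0 x with hx | hx
    · exact key x hx h
    · rw [← neg_neg x]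
      exact neg_mem (key (-x) (neg_nonneg.2 hx) fun r => by simpa using h (-r))

theorem mem_orderHyperplane_iff {a x : V} :
    x ∈ orderHyperplane (· ≤ ·) a ↔ IsInfinitesimal (· ≤ ·) x (orderAbs (· ≤ ·) a) := by
  rw [mem_orderHyperplane_iff_forall_real, orderAbs_eq_abs]
  refine ⟨fun h n => by simpa [Int.cast_smul_eq_zsmul] using h n, fun h r => ?_⟩
  rcases le_total 0 x with hx | hx
  · obtain ⟨k, hk⟩ := exists_nat_ge r
    refine (smul_le_smul_of_nonneg_right hk hx).trans ?_
    have := h k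
    rwa [natCast_zsmul, ← Nat.cast_smul_eq_nsmul ℝ] at this
  · obtain ⟨k, hk⟩ := exists_nat_ge (-r)
    have h1 := smul_le_smul_of_nonneg_right hk (neg_nonneg.2 hx)
    rw [smul_neg, neg_smul, neg_neg] at h1
    refine h1.trans ?_
    have := h (-k)
    rwa [neg_smul, natCast_zsmul, ← Nat.cast_smul_eq_nsmul ℝ, ← smul_neg] at this

theorem self_mem_orderSpan (a : V) : a ∈ orderSpan (· ≤ ·) a :=
  mem_orderSpan_iff.2 ⟨1, by simp⟩

/-- If `s ≠ 0`, every real multiple of `a` would be at most `|a|`, including `2 • |a|`. This makes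
the coefficient modulo `H_a` unique. -/
theorem smul_self_mem_orderHyperplane {a : V} {s : ℝ} (ha : a ≠ 0)
    (h : s • a ∈ orderHyperplane (· ≤ ·) a) : s = 0 := by
  rw [mem_orderHyperplane_iff_forall_real] at h
  by_contra hs
  have key : ∀ c : ℝ, c • a ≤ |a| := fun c => by
    simpa [smul_smul, hs] using h (c / s)
  have hpos : 0 < |a| := abs_pos.2 ha
  have : (2 : ℝ) • |a| ≤ |a| := by
    rcases abs_choice a with h' | h'
    · conv_lhs => rw [h']
      exact key 2
    · conv_lhs => rw [h']
      simpa using key (-2)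
  rw [two_smul] at this
  exact absurd this (not_le.2 (lt_add_of_pos_left _ hpos))

/-- Every vector of `V_a` differs from a multiple of `|a|` by an element of `H_a`; the coefficient
is read off from the rational multiples of `|a|` below the vector. -/
theorem sub_sSup_smul_mem_orderHyperplane {a x : V} (hx : x ∈ orderSpan (· ≤ ·) a) :
    x - (sSup {r : ℝ | ∃ q : ℚ, (q : ℝ) = r ∧ (q : ℝ) • |a| ≤ x}) • |a| ∈
      orderHyperplane (· ≤ ·) a := by
  obtain ⟨n, hn⟩ := mem_orderSpan_iff.1 hx
  rcases eq_or_ne a 0 with rfl | ha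
  · have : x = 0 := by simpa using hn
    rw [this, abs_zero, smul_zero, sub_zero]
    exact zero_mem _
  have hpos : 0 < |a| := abs_pos.2 ha
  have hmono : ∀ {r t : ℝ}, r • |a| ≤ t • |a| → r ≤ t := fun {r t} h => by
    by_contra hlt
    push Not at hlt
    have h1 : (r - t) • |a| ≤ 0 := by rw [sub_smul]; exact sub_nonpos.2 h
    have h2 : |a| ≤ 0 := by
      have := smul_le_smul_of_nonneg_left h1 (inv_nonneg.2 (sub_pos.2 hlt).le)
      rwa [smul_smul, inv_mul_cancel₀ (sub_pos.2 hlt).ne', one_smul, smul_zero] at this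
    exact absurd h2 (not_le.2 hpos)
  set S := {r : ℝ | ∃ q : ℚ, (q : ℝ) = r ∧ (q : ℝ) • |a| ≤ x} with hS
  obtain ⟨hlow, hup⟩ := abs_le.1 hn
  have hbdd : BddAbove S := by
    refine ⟨n, ?_⟩
    rintro _ ⟨q, rfl, hq⟩
    exact hmono (hq.trans hup)
  have hne : S.Nonempty := ⟨((-n : ℚ) : ℝ), -n, rfl, by push_cast; rwa [neg_smul]⟩
  have upper : ∀ ε : ℝ, 0 < ε → x ≤ (sSup S + ε) • |a| := by
    intro ε hε
    -- A rational above `sSup S` is outside `S`, so by totality its multiple of `|a|` lies above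
    -- `x`.
    obtain ⟨q, hq1, hq2⟩ := exists_rat_btwn (lt_add_of_pos_right (sSup S) hε)
    have : x ≤ (q : ℝ) • |a| := by
      by_contra hcon
      exact absurd (le_csSup hbdd ⟨q, rfl, (not_le.1 hcon).le⟩) (not_le.2 hq1)
    exact this.trans (smul_le_smul_of_nonneg_right hq2.le hpos.le)
  have lower : ∀ ε : ℝ, 0 < ε → (sSup S - ε) • |a| ≤ x := by
    intro ε hε
    obtain ⟨_, ⟨q, rfl, hq⟩, hlt⟩ := exists_lt_of_lt_csSup hne (sub_lt_self (sSup S) hε)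
    exact (smul_le_smul_of_nonneg_right hlt.le hpos.le).trans hq
  rw [mem_orderHyperplane_iff_forall_real]
  intro r
  rcases lt_trichotomy r 0 with hr | rfl | hr
  · have h1 := smul_le_smul_of_nonneg_left (lower (-r)⁻¹ (by simpa using hr)) (neg_pos.2 hr).le
    rw [sub_smul, smul_sub, smul_smul (-r) (-r)⁻¹, mul_inv_cancel₀ (neg_pos.2 hr).ne',
      one_smul, neg_smul, neg_smul] at h1
    rw [smul_sub, sub_le_iff_le_add]
    rw [sub_le_iff_le_add] at h1
    have := add_le_add_left (add_le_add_left h1 (r • x)) (r • sSup S • |a|)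
    simpa [add_comm, add_left_comm, add_assoc] using this
  · simp
  · have h1 := smul_le_smul_of_nonneg_left (upper r⁻¹ (by positivity)) hr.le
    rw [add_smul, smul_add, smul_smul r r⁻¹, mul_inv_cancel₀ hr.ne', one_smul] at h1
    rw [smul_sub, sub_le_iff_le_add']
    exact h1

theorem exists_sub_smul_mem_orderHyperplane {a x : V} (hx : x ∈ orderSpan (· ≤ ·) a) :
    ∃ s : ℝ, x - s • a ∈ orderHyperplane (· ≤ ·) a := by
  have h := sub_sSup_smul_mem_orderHyperplane hx
  rcases abs_choice a with h' | h'
  · exact ⟨_, by rw [h'] at h; exact h⟩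
  · exact ⟨-_, by rw [neg_smul, ← smul_neg]; rw [h'] at h; exact h⟩

/-- Modulo `H_a`, the sign of a vector is the sign of its `a`-component. -/
theorem nonneg_iff_of_sub_smul_mem {a x : V} {s : ℝ}
    (h : x - s • a ∈ orderHyperplane (· ≤ ·) a) (hs : s ≠ 0) (ha : a ≠ 0) :
    0 ≤ x ↔ 0 ≤ s • a := by
  rw [mem_orderHyperplane_iff_forall_real] at h
  have hpos : 0 < |a| := abs_pos.2 ha
  have habs : |s • a| = |s| • |a| := abs_smul s a
  have hbound : ∀ r : ℝ, 0 < r → |x - s • a| ≤ r⁻¹ • |a| := by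
    intro r hr
    have h1 : ∀ y : V, r • y ≤ |a| → y ≤ r⁻¹ • |a| := fun y hy => by
      have := smul_le_smul_of_nonneg_left hy (inv_nonneg.2 hr.le)
      rwa [smul_smul, inv_mul_cancel₀ hr.ne', one_smul] at this
    exact abs_le'.2 ⟨h1 _ (h r), h1 _ (by rw [smul_neg, ← neg_smul]; exact h (-r))⟩
  have hlt : |x - s • a| < |s • a| := by
    -- This `r` bounds the error by half of `|s • a|`, which leaves room for strictness.
    refine (hbound (2 / |s|) (by positivity)).trans_lt ?_
    have h2 : |s • a| = (2 / |s|)⁻¹ • |a| + (2 / |s|)⁻¹ • |a| := by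
      rw [habs, ← add_smul]
      congr 1
      field_simp
      norm_num
    rw [h2]
    refine lt_add_of_pos_left _ (lt_of_le_of_ne (smul_nonneg (by positivity) hpos.le) ?_)
    exact (smul_ne_zero (by positivity) hpos.ne').symm
  constructor
  · intro hx
    by_contra hneg
    push Not at hneg
    rw [abs_of_neg hneg] at hlt
    have := (le_abs_self _).trans_lt hlt
    rw [sub_lt_iff_lt_add, neg_add_cancel] at this
    exact absurd this (not_lt.2 hx)
  · intro hsa
    rw [abs_of_nonneg hsa] at hlt
    have := (neg_le_abs _).trans_lt hlt
    rw [neg_sub, sub_lt_self_iff] at this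
    exact this.le

theorem smul_nonneg_iff_pos_iff {a : V} {s : ℝ} (hs : s ≠ 0) (ha : a ≠ 0) :
    0 ≤ s • a ↔ (0 < s ↔ 0 ≤ a) := by
  have key : ∀ {t : ℝ} {b : V}, 0 < t → 0 ≤ t • b → 0 ≤ b := fun {t b} ht h => by
    have := smul_nonneg (inv_nonneg.2 ht.le) h
    rwa [smul_smul, inv_mul_cancel₀ ht.ne', one_smul] at this
  rcases lt_or_gt_of_ne hs with h | h
  · have h1 : 0 ≤ s • a ↔ ¬ 0 ≤ a := by
      rw [← neg_smul_neg, not_le, lt_iff_le_and_ne, ← neg_nonneg (a := a)]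
      exact ⟨fun h' => ⟨key (neg_pos.2 h) h', ha⟩, fun h' => smul_nonneg (neg_pos.2 h).le h'.1⟩
    rw [h1]
    simp [not_lt.2 h.le]
  · simp only [h, true_iff]
    exact ⟨key h, smul_nonneg h.le⟩

end Ordered

theorem rationalVectors_sub {ι : Type*} {x y : ι →₀ ℝ} (hx : x ∈ rationalVectors ι)
    (hy : y ∈ rationalVectors ι) : x - y ∈ rationalVectors ι := by
  intro i
  obtain ⟨p, hp⟩ := hx i
  obtain ⟨q, hq⟩ := hy i
  exact ⟨p - q, by simp [hp, hq]⟩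

theorem rationalVectors_smul {ι : Type*} {x : ι →₀ ℝ} (hx : x ∈ rationalVectors ι) (r : ℚ) :
    (r : ℝ) • x ∈ rationalVectors ι := by
  intro i
  obtain ⟨p, hp⟩ := hx i
  exact ⟨r * p, by simp [hp]⟩

theorem rationalVectors_neg {ι : Type*} {x : ι →₀ ℝ} (hx : x ∈ rationalVectors ι) :
    -x ∈ rationalVectors ι := by
  simpa using rationalVectors_smul hx (-1)

theorem orderAbs_mem_rationalVectors {ι : Type*} (le : (ι →₀ ℝ) → (ι →₀ ℝ) → Prop) {a : ι →₀ ℝ}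
    (ha : a ∈ rationalVectors ι) : orderAbs le a ∈ rationalVectors ι := by
  unfold orderAbs
  split_ifs
  · exact ha
  · exact rationalVectors_neg ha

/-! ### The same facts for order relations, so that two orders can be compared. -/

namespace IsLinearVectorOrder

variable {V : Type*} [AddCommGroup V] [Module ℝ V] {le : V → V → Prop}

theorem le_iff_sub_nonneg (h : IsLinearVectorOrder le) (x y : V) : le x y ↔ le 0 (y - x) := by
  obtain ⟨o, rfl, _, _⟩ := h.exists_linearOrder
  exact sub_nonneg.symm

theorem nonneg_smul_iff (h : IsLinearVectorOrder le) {x : V} {c : ℝ} (hc : 0 < c) :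
    le 0 (c • x) ↔ le 0 x := by
  refine ⟨fun hx => ?_, h.smul_nonneg c x hc.le⟩
  have := h.smul_nonneg c⁻¹ _ (inv_nonneg.2 hc.le) hx
  rwa [smul_smul, inv_mul_cancel₀ hc.ne', one_smul] at this

/-- The bounds are rational multiples of `|a|`, so for rational `a` and `x` only rational vectors
are compared. -/
theorem mem_orderSpan_iff (h : IsLinearVectorOrder le) {a x : V} :
    x ∈ orderSpan le a ↔
      ∃ n : ℕ, le (((-n : ℚ) : ℝ) • orderAbs le a) x ∧ le x (((n : ℚ) : ℝ) • orderAbs le a) := by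
  obtain ⟨o, rfl, _, _⟩ := h.exists_linearOrder
  have habs : orderAbs o.le a = |a| := orderAbs_eq_abs a
  rw [habs]
  refine _root_.mem_orderSpan_iff.trans (exists_congr fun n => abs_le.trans ?_)
  push_cast
  rw [neg_smul]

theorem mem_orderHyperplane_iff (h : IsLinearVectorOrder le) {a x : V} :
    x ∈ orderHyperplane le a ↔ ∀ n : ℤ, le (n • x) (orderAbs le a) := by
  obtain ⟨o, rfl, _, _⟩ := h.exists_linearOrder
  exact _root_.mem_orderHyperplane_iff

theorem self_mem_orderSpan (h : IsLinearVectorOrder le) (a : V) : a ∈ orderSpan le a := by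
  obtain ⟨o, rfl, _, _⟩ := h.exists_linearOrder
  exact _root_.self_mem_orderSpan a

theorem smul_self_mem_orderHyperplane (h : IsLinearVectorOrder le) {a : V} {s : ℝ} (ha : a ≠ 0)
    (hs : s • a ∈ orderHyperplane le a) : s = 0 := by
  obtain ⟨o, rfl, _, _⟩ := h.exists_linearOrder
  exact _root_.smul_self_mem_orderHyperplane ha hs

theorem sub_sSup_smul_mem_orderHyperplane (h : IsLinearVectorOrder le) {a x : V}
    (hx : x ∈ orderSpan le a) :
    x - (sSup {r : ℝ | ∃ q : ℚ, (q : ℝ) = r ∧ le ((q : ℝ) • orderAbs le a) x}) • orderAbs le a ∈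
      orderHyperplane le a := by
  obtain ⟨o, rfl, _, _⟩ := h.exists_linearOrder
  have habs : orderAbs o.le a = |a| := orderAbs_eq_abs a
  rw [habs]
  exact _root_.sub_sSup_smul_mem_orderHyperplane hx

theorem exists_sub_smul_mem_orderHyperplane (h : IsLinearVectorOrder le) {a x : V}
    (hx : x ∈ orderSpan le a) : ∃ s : ℝ, x - s • a ∈ orderHyperplane le a := by
  obtain ⟨o, rfl, _, _⟩ := h.exists_linearOrder
  exact _root_.exists_sub_smul_mem_orderHyperplane hx

theorem nonneg_iff_of_sub_smul_mem (h : IsLinearVectorOrder le) {a x : V} {s : ℝ}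
    (hx : x - s • a ∈ orderHyperplane le a) (hs : s ≠ 0) (ha : a ≠ 0) :
    le 0 x ↔ (0 < s ↔ le 0 a) := by
  obtain ⟨o, rfl, _, _⟩ := h.exists_linearOrder
  exact (_root_.nonneg_iff_of_sub_smul_mem hx hs ha).trans (smul_nonneg_iff_pos_iff hs ha)

end IsLinearVectorOrder

/-! ### Comparison of two orders at a rational vector. -/

/-- If two orders are not distinguished at `a`, then neither are they by the signs of the rational
vectors in `V_a`. -/
theorem nonneg_of_not_differAt {ι : Type*} {R R' : (ι →₀ ℝ) → (ι →₀ ℝ) → Prop}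
    (hR : IsLinearVectorOrder R) (hR' : IsLinearVectorOrder R') {a x : ι →₀ ℝ}
    (ha : a ∈ rationalVectors ι) (hd : ¬ DifferAt R R' a) (hsign : R 0 a ↔ R' 0 a)
    (hx : x ∈ rationalVectors ι) (hxa : x ∈ orderSpan R a) (h0 : R 0 x) : R' 0 x := by
  unfold DifferAt at hd
  push Not at hd
  obtain ⟨hhyp, -, hpos⟩ := hd
  by_cases hxH : x ∈ orderHyperplane R a
  · have : x ∈ positivePart R (orderHyperplane R a) ∩ rationalVectors ι := ⟨⟨hxH, h0⟩, hx⟩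
    rw [hpos] at this
    exact this.1.2
  · obtain ⟨s, hs⟩ := hR.exists_sub_smul_mem_orderHyperplane hxa
    have hsa : s • a ≠ 0 := fun h => hxH (by rwa [h, sub_zero] at hs)
    obtain ⟨hs0, ha0⟩ := smul_ne_zero_iff.1 hsa
    have hact : x - s • a ∈ activeSubspace (orderSpan R a) :=
      sub_mem (Submodule.subset_span ⟨hx, hxa⟩)
        (Submodule.smul_mem _ _ (Submodule.subset_span ⟨ha, hR.self_mem_orderSpan a⟩))
    have hmem : x - s • a ∈ orderHyperplane R a ⊓ activeSubspace (orderSpan R a) := ⟨hs, hact⟩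
    rw [hhyp] at hmem
    rw [hR'.nonneg_iff_of_sub_smul_mem hmem.1 hs0 ha0, ← hsign]
    exact (hR.nonneg_iff_of_sub_smul_mem hs hs0 ha0).1 h0

/-- Orders agreeing on the rational vectors are not distinguished at any rational vector. -/
theorem not_differAt_of_nonneg_iff {ι : Type*} {R R' : (ι →₀ ℝ) → (ι →₀ ℝ) → Prop}
    (hR : IsLinearVectorOrder R) (hR' : IsLinearVectorOrder R')
    (hagree : ∀ x ∈ rationalVectors ι, (R 0 x ↔ R' 0 x)) {a : ι →₀ ℝ}
    (ha : a ∈ rationalVectors ι) : ¬ DifferAt R R' a := by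
  have hle : ∀ {x y}, x ∈ rationalVectors ι → y ∈ rationalVectors ι → (R x y ↔ R' x y) :=
    fun {x y} hx hy => by
      rw [hR.le_iff_sub_nonneg, hR'.le_iff_sub_nonneg, hagree _ (rationalVectors_sub hy hx)]
  have habs : orderAbs R a = orderAbs R' a := by
    unfold orderAbs
    by_cases h : R 0 a
    · rw [if_pos h, if_pos ((hagree a ha).1 h)]
    · rw [if_neg h, if_neg (mt (hagree a ha).2 h)]
  have hb : orderAbs R' a ∈ rationalVectors ι := orderAbs_mem_rationalVectors _ ha
  have hspan : ∀ x ∈ rationalVectors ι, (x ∈ orderSpan R a ↔ x ∈ orderSpan R' a) := by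
    intro x hx
    rw [hR.mem_orderSpan_iff, hR'.mem_orderSpan_iff, habs]
    refine exists_congr fun n => and_congr (hle (rationalVectors_smul hb _) hx)
      (hle hx (rationalVectors_smul hb _))
  have hhyp : ∀ x ∈ rationalVectors ι, (x ∈ orderHyperplane R a ↔ x ∈ orderHyperplane R' a) := by
    intro x hx
    rw [hR.mem_orderHyperplane_iff, hR'.mem_orderHyperplane_iff, habs]
    refine forall_congr' fun n => hle ?_ hb
    have := rationalVectors_smul hx n
    rwa [Rat.cast_intCast, Int.cast_smul_eq_zsmul] at this
  have hact : activeSubspace (orderSpan R a) = activeSubspace (orderSpan R' a) := by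
    unfold activeSubspace
    congr 1
    ext x
    exact and_congr_right fun hx => hspan x hx
  -- One coefficient serves both orders; this is linear in `y`, so rational `y` suffice.
  have hcommon : ∀ y ∈ activeSubspace (orderSpan R a), ∃ s : ℝ,
      y - s • orderAbs R' a ∈ orderHyperplane R a ∧
        y - s • orderAbs R' a ∈ orderHyperplane R' a := by
    intro y hy
    induction hy using Submodule.span_induction with
    | mem x hx =>
      have h1 := hR.sub_sSup_smul_mem_orderHyperplane hx.2
      have h2 := hR'.sub_sSup_smul_mem_orderHyperplane ((hspan x hx.1).1 hx.2)
      rw [habs] at h1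
      -- Only rational vectors are compared in the set of `q`, so the two suprema coincide.
      simp only [hle (rationalVectors_smul hb _) hx.1] at h1
      exact ⟨_, h1, h2⟩
    | zero => exact ⟨0, by simp, by simp⟩
    | add x y _ _ hx hy =>
      obtain ⟨s, h1, h2⟩ := hx
      obtain ⟨t, h3, h4⟩ := hy
      refine ⟨s + t, ?_, ?_⟩
      · rw [add_smul, add_sub_add_comm]
        exact add_mem h1 h3
      · rw [add_smul, add_sub_add_comm]
        exact add_mem h2 h4
    | smul c x _ hx =>
      obtain ⟨s, h1, h2⟩ := hx
      refine ⟨c * s, ?_, ?_⟩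
      · rw [mul_smul, ← smul_sub]
        exact Submodule.smul_mem _ c h1
      · rw [mul_smul, ← smul_sub]
        exact Submodule.smul_mem _ c h2
  have hzero : ∀ {Q : (ι →₀ ℝ) → (ι →₀ ℝ) → Prop}, IsLinearVectorOrder Q → ∀ {s : ℝ},
      s • orderAbs R' a ∈ orderHyperplane Q a → s • orderAbs R' a = 0 := by
    intro Q hQ s hs
    rcases eq_or_ne a 0 with rfl | ha0
    · simp [orderAbs]
    · have h0 : s = 0 := by
        unfold orderAbs at hs
        split_ifs at hs
        · exact hQ.smul_self_mem_orderHyperplane ha0 hs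
        · rw [smul_neg, ← neg_smul] at hs
          exact neg_eq_zero.1 (hQ.smul_self_mem_orderHyperplane ha0 hs)
      rw [h0, zero_smul]
  unfold DifferAt
  push Not
  refine ⟨?_, hact, ?_⟩
  · rw [← hact]
    ext y
    simp only [Submodule.mem_inf]
    refine and_congr_left fun hy => ?_
    obtain ⟨s, h1, h2⟩ := hcommon y hy
    constructor
    · intro h
      -- Subtracting puts `s • |a|` into the hyperplane, so it vanishes.
      rw [hzero hR (by simpa using sub_mem h h1), sub_zero] at h2
      exact h2
    · intro h
      rw [hzero hR' (by simpa using sub_mem h h2), sub_zero] at h1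
      exact h1
  · ext x
    simp only [positivePart, Set.mem_inter_iff, Set.mem_ofPred_eq]
    exact and_congr_left fun hx => and_congr (hhyp x hx) (hagree x hx)

/-! ### From rational vectors back to `G`. -/

/-- Orders on `G` coincide if their extensions have the same signs on the rational vectors. -/
theorem eq_of_nonneg_imp {G : Type*} [AddCommGroup G] {E : Set G} (hE : IsMaximalIndependent E)
    {le le' : G → G → Prop} (hle : IsLinearGroupOrder le) (hle' : IsLinearGroupOrder le')
    {R R' : (E →₀ ℝ) → (E →₀ ℝ) → Prop} (hR : IsLinearVectorOrder R) (hR' : IsLinearVectorOrder R')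
    (hind : Induces hE R le) (hind' : Induces hE R' le')
    (himp : ∀ x ∈ rationalVectors E, R 0 x → R' 0 x) : le = le' := by
  have hsub : ∀ g h, le g h → le' g h := by
    intro g h hgh
    rw [hind', hR'.le_iff_sub_nonneg]
    rw [hind, hR.le_iff_sub_nonneg] at hgh
    exact himp _ (rationalVectors_sub (canonicalEmbedding_mem_rationalVectors hE h)
      (canonicalEmbedding_mem_rationalVectors hE g)) hgh
  funext g h
  refine propext ⟨hsub g h, fun h' => ?_⟩
  have h1 := hle.isLinearOrder
  have h2 := hle'.isLinearOrder
  -- A linear order contained in another equals it, so one implication between signs is enough.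
  rcases h1.total g h with hgh | hgh
  · exact hgh
  · rw [h2.antisymm g h h' (hsub h g hgh)]
    exact h1.refl h

theorem Induces.nonneg_iff {G : Type*} [AddCommGroup G] {E : Set G} {hE : IsMaximalIndependent E}
    {le : G → G → Prop} {R R' : (E →₀ ℝ) → (E →₀ ℝ) → Prop} (hR : IsLinearVectorOrder R)
    (hR' : IsLinearVectorOrder R') (hind : Induces hE R le) (hind' : Induces hE R' le)
    {x : E →₀ ℝ} (hx : x ∈ rationalVectors E) : R 0 x ↔ R' 0 x := by
  obtain ⟨d, g, hd, hg⟩ := exists_nsmul_eq_canonicalEmbedding hE hx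
  have hd' : (0 : ℝ) < d := Nat.cast_pos.2 hd
  rw [← hR.nonneg_smul_iff hd', ← hR'.nonneg_smul_iff hd', hg, ← canonicalEmbedding_zero hE,
    ← hind, ← hind']

/-! ### Extending an order on `G` to a vector space order. -/

theorem HahnSeries.toLex_smul_pos {Γ : Type*} [LinearOrder Γ] {c : ℝ} (hc : 0 < c)
    {x : HahnSeries Γ ℝ} (hx : 0 < toLex x) : 0 < toLex (c • x) := by
  obtain ⟨i, hj, hi⟩ := (HahnSeries.lt_iff _ _).1 hx
  refine (HahnSeries.lt_iff _ _).2 ⟨i, fun j hji => ?_, ?_⟩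
  · have h : 0 = x.coeff j := hj j hji
    change 0 = c * x.coeff j
    rw [← h, mul_zero]
  · have h : 0 < x.coeff i := hi
    exact mul_pos hc h

theorem Finsupp.toLex_smul_nonneg {ι : Type*} [LinearOrder ι] {c : ℝ} (hc : 0 < c)
    {x : ι →₀ ℝ} (hx : toLex 0 ≤ toLex x) : toLex 0 ≤ toLex (c • x) := by
  rcases hx.eq_or_lt with h0 | ⟨i, hj, hi⟩
  · rw [← toLex.injective h0, smul_zero]
  refine le_of_lt ⟨i, fun j hji => ?_, ?_⟩
  · have h : 0 = x j := hj j hji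
    change 0 = c * x j
    rw [← h, mul_zero]
  · have h : 0 < x i := hi
    exact mul_pos hc h

/-- The real-linear extension of an additive map on `G` factors it through the canonical
embedding. -/
theorem linearCombination_canonicalEmbedding {G : Type*} [AddCommGroup G] {E : Set G}
    (hE : IsMaximalIndependent E) {W : Type*} [AddCommGroup W] [Module ℝ W] (f : G →+ W) (g : G) :
    Finsupp.linearCombination ℝ (fun e : E => f e) (canonicalEmbedding hE g) = f g := by
  obtain ⟨q, p, hq, h⟩ := hE.exists_multiple g
  have hq' : (q : ℝ) ≠ 0 := by positivity
  have hval : canonicalEmbedding hE g =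
      (q : ℝ)⁻¹ • p.mapRange (fun n : ℤ => (n : ℝ)) Int.cast_zero := by
    ext e
    simp [canonicalEmbedding_eq hE hq h]
  have hp : Finsupp.linearCombination ℝ (fun e : E => f e)
      (p.mapRange (fun n : ℤ => (n : ℝ)) Int.cast_zero) = (q : ℝ) • f g := by
    rw [Nat.cast_smul_eq_nsmul, ← map_nsmul, h, Finsupp.linearCombination_apply,
      Finsupp.linearCombination_apply, Finsupp.sum_mapRange_index (by simp), Finsupp.sum,
      Finsupp.sum, map_sum]
    simp [Int.cast_smul_eq_zsmul]
  rw [hval, map_smul, hp, smul_smul, inv_mul_cancel₀ hq', one_smul]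

/-- Every linear order on `G` extends, along the canonical embedding, to a linear vector space
order: extend a Hahn embedding of `G` linearly, and break ties lexicographically. -/
theorem exists_isLinearVectorOrder_induces {G : Type*} [AddCommGroup G] {E : Set G}
    (hE : IsMaximalIndependent E) {le : G → G → Prop} (hle : IsLinearGroupOrder le) :
    ∃ R : (E →₀ ℝ) → (E →₀ ℝ) → Prop, IsLinearVectorOrder R ∧ Induces hE R le := by
  classical
  have hl := hle.isLinearOrder
  let o : LinearOrder G :=
    { le := le
      le_refl := hl.refl
      le_trans := hl.trans
      le_antisymm := hl.antisymm
      le_total := hl.total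
      toDecidableLE := Classical.decRel _ }
  have hG : IsOrderedAddMonoid G :=
    { add_le_add_left := fun a b hab c => hle.add_le_add a b c hab }
  -- Any linear order on `E` would do; it only serves the lexicographic tie-break.
  let _ : LinearOrder E := linearOrderOfSTO WellOrderingRel
  obtain ⟨f, hf, -⟩ := hahnEmbedding_isOrderedAddMonoid G
  have hfle : ∀ g h : G, f g ≤ f h ↔ le g h := fun g h =>
    (f.monotone'.strictMono_of_injective hf).le_iff_le
  let f₀ : G →+ HahnSeries (FiniteArchimedeanClass G) ℝ :=
    { toFun := fun g => ofLex (f g)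
      map_zero' := congrArg ofLex (map_zero f)
      map_add' := fun g h => congrArg ofLex (map_add f g h) }
  let L : (E →₀ ℝ) →ₗ[ℝ] HahnSeries (FiniteArchimedeanClass G) ℝ :=
    Finsupp.linearCombination ℝ fun e : E => f₀ e
  have hL : ∀ g, L (canonicalEmbedding hE g) = f₀ g :=
    linearCombination_canonicalEmbedding hE f₀
  -- `L` may have a kernel although `f` is injective; the second component restores injectivity.
  let F : (E →₀ ℝ) → Lex (HahnSeries (FiniteArchimedeanClass G) ℝ) ×ₗ Lex (E →₀ ℝ) :=
    fun x => toLex (toLex (L x), toLex x)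
  have hF : Function.Injective F := fun x y hxy =>
    toLex.injective (congrArg Prod.snd (toLex.injective hxy))
  have hFle : ∀ x y, F x ≤ F y ↔
      toLex (L x) < toLex (L y) ∨ toLex (L x) = toLex (L y) ∧ toLex x ≤ toLex y :=
    fun x y => Prod.Lex.toLex_le_toLex
  refine ⟨fun x y => F x ≤ F y, ?_, ?_⟩
  · refine { isLinearOrder := ?_, add_le_add := ?_, smul_nonneg := ?_ }
    · exact hF.isLinearOrder_onFun (r := (· ≤ ·))
    · intro x y z h
      rw [hFle] at h ⊢
      rw [map_add L, map_add L]
      rcases h with h | ⟨h, h'⟩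
      · exact Or.inl (add_lt_add_left h (toLex (L z)))
      · exact Or.inr ⟨by rw [toLex.injective h], add_le_add_left h' (toLex z)⟩
    · intro c x hc h
      rcases hc.eq_or_lt with rfl | hc
      · rw [zero_smul]
      rw [hFle, map_zero] at h
      rw [hFle, map_zero, map_smul]
      rcases h with h | ⟨h, h'⟩
      · exact Or.inl (HahnSeries.toLex_smul_pos hc h)
      · exact Or.inr ⟨by rw [← toLex.injective h, smul_zero], Finsupp.toLex_smul_nonneg hc h'⟩
  · intro g h
    change le g h ↔ F (canonicalEmbedding hE g) ≤ F (canonicalEmbedding hE h)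
    rw [hFle, hL, hL, ← hfle]
    constructor
    · intro hgh
      rcases hgh.lt_or_eq with h1 | h1
      · exact Or.inl h1
      -- On the image of `G` a tie forces `g = h`, so the tie-break does not affect the induced
      -- order.
      · exact Or.inr ⟨h1, by rw [hf h1]⟩
    · rintro (h1 | h1)
      · exact h1.le
      · exact h1.1.le

theorem theorem24 {G : Type*} [AddCommGroup G] [IsAddTorsionFree G] (E : Set G)
    (hE : IsMaximalIndependent E) :
    (∀ le : G → G → Prop, IsLinearGroupOrder le →
      ∃ R : (E →₀ ℝ) → (E →₀ ℝ) → Prop, IsLinearVectorOrder R ∧ Induces hE R le) ∧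
    ∀ (le le' : G → G → Prop), IsLinearGroupOrder le → IsLinearGroupOrder le' →
      ∀ (R R' : (E →₀ ℝ) → (E →₀ ℝ) → Prop), IsLinearVectorOrder R → IsLinearVectorOrder R' →
        Induces hE R le → Induces hE R' le' →
        ∀ U : Set (E →₀ ℝ), U ⊆ rationalVectors E →
          (⋃ a ∈ U, (orderSpan R a : Set (E →₀ ℝ))) = Set.univ →
          (le ≠ le' ↔ ∃ a ∈ U, DifferAt R R' a ∨ ¬ (R 0 a ↔ R' 0 a)) ∧
          ((∀ a ∈ U, (R 0 a ↔ R' 0 a)) → (le ≠ le' ↔ ∃ a ∈ U, DifferAt R R' a)) := by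
  refine ⟨fun le hle => exists_isLinearVectorOrder_induces hE hle, ?_⟩
  intro le le' hle hle' R R' hR hR' hind hind' U hU hcover
  have main : le ≠ le' ↔ ∃ a ∈ U, DifferAt R R' a ∨ ¬ (R 0 a ↔ R' 0 a) := by
    constructor
    · intro hne
      by_contra! hcon
      refine hne (eq_of_nonneg_imp hE hle hle' hR hR' hind hind' fun x hx h0 => ?_)
      have hxU : x ∈ ⋃ a ∈ U, (orderSpan R a : Set (E →₀ ℝ)) := hcover ▸ Set.mem_univ x
      simp only [Set.mem_iUnion] at hxU
      obtain ⟨a, ha, hxa⟩ := hxU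
      exact nonneg_of_not_differAt hR hR' (hU ha) (hcon a ha).1 (hcon a ha).2 hx hxa h0
    · rintro ⟨a, ha, h⟩ rfl
      have hagree : ∀ x ∈ rationalVectors E, (R 0 x ↔ R' 0 x) := fun x hx =>
        Induces.nonneg_iff hR hR' hind hind' hx
      rcases h with h | h
      · exact not_differAt_of_nonneg_iff hR hR' hagree (hU ha) h
      · exact h (hagree a (hU ha))
  refine ⟨main, fun hsign => main.trans (exists_congr fun a => and_congr_right fun ha => ?_)⟩
  exact or_iff_left (not_not.2 (hsign a ha))
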